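/- Fix an integer $r\ge 0$. An ($r$-coloured) permutation of length $|a|=n\ge 0$ is a word $a=\sigma_1^{\gamma_1}\cdots\sigma_n^{\gamma_n}$ with distinct symbols $\sigma_i\in\{1,2,\dots\}$ and arbitrary colours $\gamma_i\in\{0,\dots,r-1\}$. Order coloured integers by: $\sigma^{\gamma}<\tau^{\delta}$ if and only if $\gamma>\delta$, or $\gamma=\delta$ and $\sigma<\tau$. Let $\mathrm{Des}(a)$ consist of all $i\in\{1,\dots,n-1\}$ with $\sigma_i^{\gamma_i}>\sigma_{i+1}^{\gamma_{i+1}}$, together with $0$ if $n\ge1$ and $\gamma_1\ne 0$. Put $\mathrm{des}(a)=|\mathrm{Des}(a)|$, $\mathrm{comaj}(a)=\sum_{i\in\mathrm{Des}(a)}(n-i)$, and $\mathrm{col}(a)=(\mathrm{col}_0(a),\dots,\mathrm{col}_{r-1}(a))$, where $\mathrm{col}_j(a)$ is the number of $i$ with $\gamma_i=j$. Write $[a]$ for the class of all $r$-coloured permutations that have the same length and the same value of $(\mathrm{des},\mathrm{comaj},\mathrm{col})$ as $a$. The statistic $(\mathrm{des},\mathrm{comaj},\mathrm{col})$ is shuffle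 compatible: for $a,b$ with disjoint symbol sets, the multiset of its values on the shuffles of $a$ and $b$ depends only on its values at $a$ and $b$ and on $|a|$, $|b|$. Let $\mathcal A$ be its shuffle algebra, that is, the commutative unital $\mathbb Q$-algebra with $\mathbb{Q}$-basis the classes $[a]$ and multiplication $[a][b]=\sum_c [c]$, where $a,b$ are representatives with disjoint symbol sets and $c$ runs over the shuffles of $a$ and $b$. Let $\mathbb Q[p_0,\dots,p_{r-1},x,z][[t]]$ be equipped with the Hadamard product $(\sum_k f_kt^k)*(\sum_k g_kt^k)=\sum_k f_kg_kt^k$ as its multiplication. Then the linear map from $\mathcal A$ to $\mathbb Q[p_0,\dots,p_{r-1},x,z][[t]]$ defined by $$[a]\mapsto \begin{cases}\dfrac{p_0^{\mathrm{col}_0(a)}\cdots p_{r-1}^{\mathrm{col}_{r-1}(a)}\,x^{\mathrm{comaj}(a)}\,t^{\mathrm{des}(a)+1}}{(1-t)(1-xt)\cdots(1-x^{|a|}t)}\,z^{|a|}, & |a|\ge 1,\\[2ex] \dfrac{1}{1-t}, & |a|=0,\end{cases}$$ is an injective homomorphism of unital $\mathbb Q$-algebras. -/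

import Mathlib

namespace ColouredShuffle

/-! ### Coloured permutations -/

/-- An `r`-coloured permutation: a finite word of coloured positive integers `σ₁^γ₁ ⋯ σₙ^γₙ`
(the pair `(σ, γ)` stands for `σ^γ`) with distinct symbols and colours in `{0, …, r-1}`. -/
@[ext]
structure ColPerm (r : ℕ) where
  word : List (ℕ+ × Fin r)
  nodup : (word.map Prod.fst).Nodup

/-- The colour order on coloured integers: larger colours come first, and the symbols decide
within one colour. -/
def ColourLT {r : ℕ} (u v : ℕ+ × Fin r) : Prop :=
  v.2 < u.2 ∨ (u.2 = v.2 ∧ u.1 < v.1)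

instance {r : ℕ} (u v : ℕ+ × Fin r) : Decidable (ColourLT u v) := by
  unfold ColourLT; infer_instance

namespace ColPerm

variable {r : ℕ}

/-- The length `|a|`. -/
def length (a : ColPerm r) : ℕ := a.word.length

/-- The set of symbols of `a`. -/
def symbols (a : ColPerm r) : Finset ℕ+ := (a.word.map Prod.fst).toFinset

/-- Symbol-disjointness. -/
def Disj (a b : ColPerm r) : Prop := Disjoint a.symbols b.symbols

/-- The descent set.  An index `1 ≤ i ≤ n - 1` belongs to it if the `i`-th letter exceeds the
`(i+1)`-st one in the colour order (the list is indexed from `0`); the index `0` belongs to it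
if there is a first letter and its colour is not `0`. -/
def Des (a : ColPerm r) : Finset ℕ :=
  {i ∈ Finset.range a.word.length | ∃ h : i < a.word.length,
    if i = 0 then (a.word[i].2 : ℕ) ≠ 0 else ColourLT a.word[i] a.word[i - 1]}

/-- The descent number. -/
def des (a : ColPerm r) : ℕ := a.Des.card

/-- The comajor index. -/
def comaj (a : ColPerm r) : ℕ := ∑ i ∈ a.Des, (a.length - i)

/-- The colour vector: `col a j` is the number of letters of colour `j`. -/
def col (a : ColPerm r) (j : Fin r) : ℕ := (a.word.map Prod.snd).count j

/-- The empty coloured permutation. -/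
def empty (r : ℕ) : ColPerm r := ⟨[], by simp⟩

/-- `a = σ^γ` and `b = π^γ` have the same length, the same colours and the same relative order
of symbols. -/
structure SameOrder (a b : ColPerm r) : Prop where
  colours : a.word.map Prod.snd = b.word.map Prod.snd
  order : ∀ (i j : ℕ) (hi : i < a.word.length) (hj : j < a.word.length)
    (hi' : i < b.word.length) (hj' : j < b.word.length),
    a.word[i].1 < a.word[j].1 ↔ b.word[i].1 < b.word[j].1

end ColPerm

/-! ### Shuffles -/

/-- The shuffles (interleavings) of two words, with multiplicity. -/
def wordShuffle {α : Type*} : List α → List α → Multiset (List α)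
  | [], m => {m}
  | x :: l, [] => {x :: l}
  | x :: l, y :: m =>
    (wordShuffle l (y :: m)).map (List.cons x) + (wordShuffle (x :: l) m).map (List.cons y)
termination_by l m => l.length + m.length

section Words

variable {α : Type*}

theorem wordShuffle_nil_left (m : List α) : wordShuffle [] m = {m} := by
  rw [wordShuffle]

theorem wordShuffle_nil_right (l : List α) : wordShuffle l [] = {l} := by
  cases l <;> rw [wordShuffle]

theorem wordShuffle_cons_cons (x y : α) (l m : List α) :
    wordShuffle (x :: l) (y :: m) =
      (wordShuffle l (y :: m)).map (List.cons x) + (wordShuffle (x :: l) m).map (List.cons y) := by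
  rw [wordShuffle]

theorem perm_of_mem_wordShuffle (l m : List α) :
    ∀ w ∈ wordShuffle l m, w.Perm (l ++ m) := by
  induction l generalizing m with
  | nil => intro w hw; simp [wordShuffle_nil_left] at hw; simp [hw]
  | cons x l ihl =>
    induction m with
    | nil => intro w hw; simp [wordShuffle_nil_right] at hw; simp [hw]
    | cons y m ihm =>
      intro w hw
      rw [wordShuffle_cons_cons, Multiset.mem_add, Multiset.mem_map, Multiset.mem_map] at hw
      rcases hw with ⟨v, hv, rfl⟩ | ⟨v, hv, rfl⟩
      · exact (ihl _ v hv).cons x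
      · exact ((ihm v hv).cons y).trans (List.perm_middle (l₁ := x :: l)).symm

theorem wordShuffle_comm (l m : List α) : wordShuffle l m = wordShuffle m l := by
  induction l generalizing m with
  | nil => rw [wordShuffle_nil_left, wordShuffle_nil_right]
  | cons x l ihl =>
    induction m with
    | nil => rw [wordShuffle_nil_left, wordShuffle_nil_right]
    | cons y m ihm =>
      rw [wordShuffle_cons_cons, wordShuffle_cons_cons, ihl, ihm, add_comm]

theorem bind_singleton_self {β : Type*} (s : Multiset β) : (s.bind fun c => {c}) = s :=
  (Multiset.bind_singleton s id).trans s.map_id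

theorem wordShuffle_assoc (l m n : List α) :
    (wordShuffle l m).bind (fun c => wordShuffle c n) =
      (wordShuffle m n).bind (fun e => wordShuffle l e) := by
  induction l generalizing m n with
  | nil => simp [wordShuffle_nil_left, bind_singleton_self]
  | cons x l ihl =>
    induction m generalizing n with
    | nil => simp [wordShuffle_nil_left, wordShuffle_nil_right]
    | cons y m ihm =>
      induction n with
      | nil => simp [wordShuffle_nil_right, bind_singleton_self]
      | cons z n ihn =>
        have h1 := ihl (y :: m) (z :: n)
        have h2 := ihm (z :: n)
        simp only [wordShuffle_cons_cons, Multiset.add_bind, Multiset.bind_map, Multiset.bind_add,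
          ← Multiset.map_bind] at h1 h2 ihn ⊢
        rw [h1, h2, ← ihn]
        simp only [Multiset.map_add]
        abel

end Words

namespace ColPerm

variable {r : ℕ}

theorem word_nodup_of_shuffle {a b : ColPerm r} (h : a.Disj b) :
    ∀ w ∈ wordShuffle a.word b.word, (w.map Prod.fst).Nodup := by
  intro w hw
  have hp := (perm_of_mem_wordShuffle _ _ w hw).map Prod.fst
  rw [hp.nodup_iff, List.map_append]
  refine List.Nodup.append a.nodup b.nodup ?_
  intro s hs hs'
  exact Finset.disjoint_left.mp h (List.mem_toFinset.mpr hs) (List.mem_toFinset.mpr hs')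

/-- The multiset `a ⧢ b` of all shuffles of symbol-disjoint coloured permutations. -/
def shuffle (a b : ColPerm r) (h : a.Disj b) : Multiset (ColPerm r) :=
  (wordShuffle a.word b.word).pmap ColPerm.mk (word_nodup_of_shuffle h)

theorem length_of_mem_shuffle {a b c : ColPerm r} (h : a.Disj b) (hc : c ∈ a.shuffle b h) :
    c.length = a.length + b.length := by
  rw [shuffle, Multiset.mem_pmap] at hc
  obtain ⟨w, hw, rfl⟩ := hc
  simpa [length] using (perm_of_mem_wordShuffle _ _ w hw).length_eq

theorem symbols_of_mem_shuffle {a b c : ColPerm r} (h : a.Disj b) (hc : c ∈ a.shuffle b h) :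
    c.symbols = a.symbols ∪ b.symbols := by
  rw [shuffle, Multiset.mem_pmap] at hc
  obtain ⟨w, hw, rfl⟩ := hc
  have hp := (perm_of_mem_wordShuffle _ _ w hw).map Prod.fst
  ext s
  simp only [symbols, List.mem_toFinset, Finset.mem_union]
  rw [hp.mem_iff, List.map_append, List.mem_append]

/-- The coloured permutation obtained by adding `N` to all symbols. -/
def shift (N : ℕ+) (a : ColPerm r) : ColPerm r where
  word := a.word.map (fun u => (u.1 + N, u.2))
  nodup := by
    have h : (a.word.map (fun u => (u.1 + N, u.2))).map Prod.fst =
        (a.word.map Prod.fst).map (· + N) := by simp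
    rw [h]
    exact a.nodup.map (fun x y hxy => add_right_cancel hxy)

theorem sameOrder_shift (N : ℕ+) (a : ColPerm r) : SameOrder a (a.shift N) where
  colours := by simp [shift, Function.comp_def]
  order := by intros; simp [shift]

theorem exists_sameOrder_disjoint (S : Finset ℕ+) (a : ColPerm r) :
    ∃ b, SameOrder a b ∧ Disjoint S b.symbols := by
  obtain ⟨N, hN⟩ := S.bddAbove
  refine ⟨a.shift N, sameOrder_shift _ a, ?_⟩
  rw [Finset.disjoint_left]
  intro s hs hs'
  simp only [symbols, shift, List.map_map, List.mem_toFinset, List.mem_map] at hs'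
  obtain ⟨u, -, rfl⟩ := hs'
  exact absurd (hN hs) (not_le.mpr (PNat.lt_add_left N u.1))

end ColPerm

/-! ### Coloured permutation statistics and shuffle algebras -/

/-- A coloured permutation statistic with values in `V`: a function of coloured permutations that
depends only on the colours and on the relative order of the symbols. -/
structure Statistic (r : ℕ) (V : Type*) where
  toFun : ColPerm r → V
  map_sameOrder : ∀ a b : ColPerm r, a.SameOrder b → toFun a = toFun b

namespace Statistic

variable {r : ℕ} {V : Type*}

/-- Shuffle compatibility: the multiset of values of `st` on the shuffles of `a` and `b` depends
only on `st a`, `st b`, `|a|` and `|b|`. -/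
def ShuffleCompatible (st : Statistic r V) : Prop :=
  ∀ (a b a' b' : ColPerm r) (h : a.Disj b) (h' : a'.Disj b'),
    st.toFun a = st.toFun a' → st.toFun b = st.toFun b' →
    a.length = a'.length → b.length = b'.length →
    (a.shuffle b h).map st.toFun = (a'.shuffle b' h').map st.toFun

/-- `st`-equivalence: same length and same value of `st`. -/
def setoid (st : Statistic r V) : Setoid (ColPerm r) where
  r a b := a.length = b.length ∧ st.toFun a = st.toFun b
  iseqv := ⟨fun _ => ⟨rfl, rfl⟩, fun h => ⟨h.1.symm, h.2.symm⟩,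
    fun h k => ⟨h.1.trans k.1, h.2.trans k.2⟩⟩

/-- The set of `st`-equivalence classes. -/
abbrev Class (st : Statistic r V) : Type := Quotient st.setoid

/-- The `st`-equivalence class of `a`. -/
def classOf (st : Statistic r V) (a : ColPerm r) : st.Class := Quotient.mk st.setoid a

theorem classOf_eq_iff (st : Statistic r V) (a b : ColPerm r) :
    st.classOf a = st.classOf b ↔ a.length = b.length ∧ st.toFun a = st.toFun b :=
  Quotient.eq (r := st.setoid)

theorem exists_rep (st : Statistic r V) (S : Finset ℕ+) (q : st.Class) :
    ∃ a : ColPerm r, Disjoint S a.symbols ∧ st.classOf a = q := by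
  obtain ⟨a, rfl⟩ := Quotient.exists_rep q
  obtain ⟨b, hab, hb⟩ := a.exists_sameOrder_disjoint S
  refine ⟨b, hb, ?_⟩
  refine (st.classOf_eq_iff b a).mpr ⟨?_, (st.map_sameOrder a b hab).symm⟩
  simpa [ColPerm.length] using (congrArg List.length hab.colours).symm

theorem exists_disjoint_reps (st : Statistic r V) (q q' : st.Class) :
    ∃ p : ColPerm r × ColPerm r, p.1.Disj p.2 ∧ st.classOf p.1 = q ∧ st.classOf p.2 = q' := by
  obtain ⟨a, -, ha⟩ := st.exists_rep ∅ q
  obtain ⟨b, hab, hb⟩ := st.exists_rep a.symbols q'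
  exact ⟨(a, b), hab, ha, hb⟩

end Statistic

/-- The underlying vector space of the shuffle algebra of a shuffle-compatible statistic `st`:
the `ℚ`-vector space with basis the `st`-equivalence classes. -/
def ShuffleAlgebra {r : ℕ} {V : Type*} (st : Statistic r V) (_ : st.ShuffleCompatible) : Type :=
  st.Class →₀ ℚ

namespace ShuffleAlgebra

variable {r : ℕ} {V : Type*} {st : Statistic r V} {hst : st.ShuffleCompatible}

noncomputable instance : AddCommGroup (ShuffleAlgebra st hst) :=
  inferInstanceAs (AddCommGroup (st.Class →₀ ℚ))

noncomputable instance : Module ℚ (ShuffleAlgebra st hst) :=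
  inferInstanceAs (Module ℚ (st.Class →₀ ℚ))

variable (hst) in
/-- The basis of the shuffle algebra formed by the `st`-equivalence classes. -/
noncomputable def basis : Module.Basis st.Class ℚ (ShuffleAlgebra st hst) :=
  Module.Basis.ofRepr (LinearEquiv.refl ℚ (st.Class →₀ ℚ))

variable (hst) in
/-- The basis element `[a]`. -/
noncomputable def mk (a : ColPerm r) : ShuffleAlgebra st hst := basis hst (st.classOf a)

variable (hst) in
/-- The product of two classes: the sum of the classes of all shuffles of disjoint
representatives (by `mk_mul_mk` below, the choice of the representatives does not matter). -/
noncomputable def classMul (q q' : st.Class) : ShuffleAlgebra st hst :=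
  (((Classical.choose (st.exists_disjoint_reps q q')).1.shuffle
    (Classical.choose (st.exists_disjoint_reps q q')).2
    (Classical.choose_spec (st.exists_disjoint_reps q q')).1).map (mk hst)).sum

variable (hst) in
/-- The bilinear extension of the product of classes. -/
noncomputable def mulHom :
    ShuffleAlgebra st hst →ₗ[ℚ] ShuffleAlgebra st hst →ₗ[ℚ] ShuffleAlgebra st hst :=
  (basis hst).constr ℚ (fun q => (basis hst).constr ℚ (fun q' => classMul hst q q'))

noncomputable instance : Mul (ShuffleAlgebra st hst) := ⟨fun x y => mulHom hst x y⟩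

noncomputable instance : One (ShuffleAlgebra st hst) := ⟨mk hst (ColPerm.empty r)⟩

theorem one_def : (1 : ShuffleAlgebra st hst) = mk hst (ColPerm.empty r) := rfl

theorem mul_def (x y : ShuffleAlgebra st hst) : x * y = mulHom hst x y := rfl

theorem sum_shuffle_congr {a b a' b' : ColPerm r} (h : a.Disj b) (h' : a'.Disj b')
    (ha : st.classOf a = st.classOf a') (hb : st.classOf b = st.classOf b') :
    ((a.shuffle b h).map (mk hst)).sum = ((a'.shuffle b' h').map (mk hst)).sum := by
  rw [st.classOf_eq_iff] at ha hb
  have key := hst a b a' b' h h' ha.2 hb.2 ha.1 hb.1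
  congr 1
  rw [← Multiset.rel_eq, Multiset.rel_map] at key ⊢
  refine key.mono ?_
  intro c hc d hd hcd
  have hl : c.length = d.length := by
    rw [ColPerm.length_of_mem_shuffle h hc, ColPerm.length_of_mem_shuffle h' hd, ha.1, hb.1]
  exact congrArg (basis hst) ((st.classOf_eq_iff c d).mpr ⟨hl, hcd⟩)

/-- The multiplication rule `[a] [b] = ∑_{c ∈ a ⧢ b} [c]` for disjoint `a` and `b`. -/
theorem mk_mul_mk (a b : ColPerm r) (h : a.Disj b) :
    mk hst a * mk hst b = ((a.shuffle b h).map (mk hst)).sum := by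
  rw [mul_def, mulHom, mk, mk, Module.Basis.constr_basis, Module.Basis.constr_basis, classMul]
  have spec := Classical.choose_spec (st.exists_disjoint_reps (st.classOf a) (st.classOf b))
  exact sum_shuffle_congr spec.1 h spec.2.1 spec.2.2

theorem span_mk : Submodule.span ℚ (Set.range (mk hst)) = ⊤ := by
  rw [← (basis hst).span_eq]
  congr 1
  ext x
  constructor
  · rintro ⟨a, rfl⟩
    exact ⟨_, rfl⟩
  · rintro ⟨q, rfl⟩
    obtain ⟨a, rfl⟩ := Quotient.exists_rep q
    exact ⟨a, rfl⟩

theorem exists_mk_eq (S : Finset ℕ+) (q : st.Class) :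
    ∃ a : ColPerm r, Disjoint S a.symbols ∧ mk hst a = basis hst q := by
  obtain ⟨a, hS, rfl⟩ := st.exists_rep S q
  exact ⟨a, hS, rfl⟩

open Classical in
/-- The basis element of a word with distinct symbols, and `0` for all other words. -/
noncomputable def wordMk (hst : st.ShuffleCompatible) (w : List (ℕ+ × Fin r)) :
    ShuffleAlgebra st hst :=
  if h : (w.map Prod.fst).Nodup then mk hst ⟨w, h⟩ else 0

theorem mk_mul_mk_word (a b : ColPerm r) (h : a.Disj b) :
    mk hst a * mk hst b = ((wordShuffle a.word b.word).map (wordMk hst)).sum := by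
  rw [mk_mul_mk a b h, ColPerm.shuffle, Multiset.map_pmap]
  congr 1
  rw [← Multiset.pmap_eq_map (p := fun w => (w.map Prod.fst).Nodup) (f := wordMk hst)
    (H := ColPerm.word_nodup_of_shuffle h)]
  refine Multiset.pmap_congr _ ?_
  intro w _ h1 h2
  simp [wordMk, h1]

theorem mulHom_comm (x y : ShuffleAlgebra st hst) : mulHom hst x y = mulHom hst y x := by
  suffices h : mulHom hst = (mulHom hst).flip by
    exact congrArg (fun f => f x y) h
  refine (basis hst).ext fun q => (basis hst).ext fun q' => ?_
  obtain ⟨a, -, ha⟩ := exists_mk_eq (hst := hst) ∅ q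
  obtain ⟨b, hab, hb⟩ := exists_mk_eq (hst := hst) a.symbols q'
  rw [LinearMap.flip_apply, ← ha, ← hb, ← mul_def, ← mul_def, mk_mul_mk_word a b hab,
    mk_mul_mk_word b a hab.symm, wordShuffle_comm]

theorem sum_mul_mk (s : Multiset (ColPerm r)) (y : ShuffleAlgebra st hst) :
    mulHom hst (s.map (mk hst)).sum y = (s.map (fun c => mulHom hst (mk hst c) y)).sum := by
  induction s using Multiset.induction_on with
  | empty => simp
  | cons c s ih => simp [ih]

theorem mk_mul_mk_mul_mk (a b d : ColPerm r) (hab : a.Disj b) (had : a.Disj d)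
    (hbd : b.Disj d) :
    mulHom hst (mulHom hst (mk hst a) (mk hst b)) (mk hst d) =
      (((wordShuffle a.word b.word).bind (fun c => wordShuffle c d.word)).map (wordMk hst)).sum := by
  rw [← mul_def (mk hst a), mk_mul_mk a b hab, sum_mul_mk, Multiset.map_bind, Multiset.sum_bind,
    ColPerm.shuffle, Multiset.map_pmap]
  congr 1
  rw [← Multiset.pmap_eq_map (p := fun w => (w.map Prod.fst).Nodup)
    (H := ColPerm.word_nodup_of_shuffle hab)]
  refine Multiset.pmap_congr _ ?_
  intro w hw h1 h2
  rw [← mul_def, mk_mul_mk_word]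
  have hs := ColPerm.symbols_of_mem_shuffle (c := ⟨w, h1⟩) hab
    (Multiset.mem_pmap.mpr ⟨w, hw, rfl⟩)
  rw [ColPerm.Disj, hs, Finset.disjoint_union_left]
  exact ⟨had, hbd⟩

theorem mulHom_assoc (x y z : ShuffleAlgebra st hst) :
    mulHom hst (mulHom hst x y) z = mulHom hst x (mulHom hst y z) := by
  have h1 : ∀ q q' q'', mulHom hst (mulHom hst (basis hst q) (basis hst q')) (basis hst q'') =
      mulHom hst (basis hst q) (mulHom hst (basis hst q') (basis hst q'')) := by
    intro q q' q''
    obtain ⟨a, -, ha⟩ := exists_mk_eq (hst := hst) ∅ q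
    obtain ⟨b, hab, hb⟩ := exists_mk_eq (hst := hst) a.symbols q'
    obtain ⟨d, hd, hd'⟩ := exists_mk_eq (hst := hst) (a.symbols ∪ b.symbols) q''
    rw [Finset.disjoint_union_left] at hd
    rw [← ha, ← hb, ← hd', mk_mul_mk_mul_mk a b d hab hd.1 hd.2, mulHom_comm (mk hst a),
      mk_mul_mk_mul_mk b d a hd.2 (Disjoint.symm hab) (Disjoint.symm hd.1), wordShuffle_assoc]
    simp only [wordShuffle_comm a.word]
  have h2 : ∀ q q', mulHom hst (mulHom hst (basis hst q) (basis hst q')) =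
      mulHom hst (basis hst q) ∘ₗ mulHom hst (basis hst q') :=
    fun q q' => (basis hst).ext fun q'' => h1 q q' q''
  have h3 : ∀ q, (mulHom hst).flip z ∘ₗ mulHom hst (basis hst q) =
      mulHom hst (basis hst q) ∘ₗ (mulHom hst).flip z :=
    fun q => (basis hst).ext fun q' => LinearMap.congr_fun (h2 q q') z
  have h4 : (mulHom hst).flip z ∘ₗ (mulHom hst).flip y =
      (mulHom hst).flip (mulHom hst y z) :=
    (basis hst).ext fun q => LinearMap.congr_fun (h3 q) y
  exact LinearMap.congr_fun h4 x

theorem one_mulHom (x : ShuffleAlgebra st hst) : mulHom hst (mk hst (ColPerm.empty r)) x = x := by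
  suffices h : mulHom hst (mk hst (ColPerm.empty r)) = LinearMap.id by
    rw [h, LinearMap.id_apply]
  refine (basis hst).ext fun q => ?_
  obtain ⟨a, -, ha⟩ := exists_mk_eq (hst := hst) ∅ q
  rw [← ha, ← mul_def, mk_mul_mk_word _ _ (by simp [ColPerm.Disj, ColPerm.symbols, ColPerm.empty])]
  simp [ColPerm.empty, wordShuffle_nil_left, wordMk, a.nodup]

noncomputable instance : CommRing (ShuffleAlgebra st hst) :=
  { (inferInstance : AddCommGroup (ShuffleAlgebra st hst)),
    (inferInstance : Mul (ShuffleAlgebra st hst)),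
    (inferInstance : One (ShuffleAlgebra st hst)) with
    left_distrib := fun x y z => map_add (mulHom hst x) y z
    right_distrib := fun x y z => by simp [mul_def]
    zero_mul := fun x => by simp [mul_def]
    mul_zero := fun x => by simp [mul_def]
    mul_assoc := mulHom_assoc
    one_mul := one_mulHom
    mul_one := fun x => (mulHom_comm x 1).trans (one_mulHom x)
    mul_comm := mulHom_comm }

noncomputable instance : Algebra ℚ (ShuffleAlgebra st hst) :=
  Algebra.ofModule (fun c x y => by simp [mul_def]) (fun c x y => by simp [mul_def])

end ShuffleAlgebra

/-! ### The statistic `(des, comaj, col)` -/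

theorem ColPerm.SameOrder.des_eq {r : ℕ} {a b : ColPerm r} (h : a.SameOrder b) :
    a.Des = b.Des := by
  have hl : a.word.length = b.word.length := by simpa using congrArg List.length h.colours
  have hc : ∀ (i : ℕ) (hi : i < a.word.length) (hi' : i < b.word.length),
      a.word[i].2 = b.word[i].2 := by
    intro i hi hi'
    have := List.getElem_of_eq h.colours (i := i) (by simpa using hi)
    simpa using this
  have hlt : ∀ (i j : ℕ) (hi : i < a.word.length) (hj : j < a.word.length)
      (hi' : i < b.word.length) (hj' : j < b.word.length),
      ColourLT a.word[i] a.word[j] ↔ ColourLT b.word[i] b.word[j] := by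
    intro i j hi hj hi' hj'
    unfold ColourLT
    rw [hc i hi hi', hc j hj hj', h.order i j hi hj hi' hj']
  ext i
  simp only [Des, Finset.mem_filter, Finset.mem_range, hl]
  refine and_congr_right fun hi' => ?_
  have hi : i < a.word.length := by omega
  refine ⟨fun ⟨_, k⟩ => ⟨hi', ?_⟩, fun ⟨_, k⟩ => ⟨hi', ?_⟩⟩
  · rwa [← hc i hi hi', ← hlt i (i - 1) hi (by omega) hi' (by omega)]
  · rwa [hc i hi hi', hlt i (i - 1) hi (by omega) hi' (by omega)]

/-- The statistic `(des, comaj, col)`. -/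
def desComajCol (r : ℕ) : Statistic r (ℕ × ℕ × (Fin r → ℕ)) where
  toFun a := (a.des, a.comaj, a.col)
  map_sameOrder a b h := by
    have hl : a.length = b.length := by
      simpa [ColPerm.length] using congrArg List.length h.colours
    simp only [ColPerm.des, ColPerm.comaj, h.des_eq, hl, Prod.mk.injEq, true_and]
    funext j
    simp only [ColPerm.col, h.colours]

/-! ### The Hadamard algebra -/

/-- The additive group `R⟦t⟧`, to be equipped with the Hadamard product. -/
def HadamardSeries (R : Type*) : Type _ := PowerSeries R

namespace HadamardSeries

variable {R : Type*} [CommRing R]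

noncomputable instance : AddCommGroup (HadamardSeries R) :=
  inferInstanceAs (AddCommGroup (PowerSeries R))

/-- A power series, viewed as an element of the Hadamard algebra. -/
noncomputable def of : PowerSeries R ≃+ HadamardSeries R := AddEquiv.refl (PowerSeries R)

/-- The Hadamard product `(∑ aₖ tᵏ) * (∑ bₖ tᵏ) = ∑ aₖ bₖ tᵏ`. -/
noncomputable instance : Mul (HadamardSeries R) :=
  ⟨fun f g => of (PowerSeries.mk fun k =>
    PowerSeries.coeff k (of.symm f) * PowerSeries.coeff k (of.symm g))⟩

/-- The unit `∑ tᵏ` of the Hadamard product. -/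
noncomputable instance : One (HadamardSeries R) := ⟨of (PowerSeries.mk fun _ => 1)⟩

theorem coeff_mul (f g : HadamardSeries R) (k : ℕ) :
    PowerSeries.coeff k (of.symm (f * g)) =
      PowerSeries.coeff k (of.symm f) * PowerSeries.coeff k (of.symm g) :=
  PowerSeries.coeff_mk k fun k =>
    PowerSeries.coeff k (of.symm f) * PowerSeries.coeff k (of.symm g)

theorem coeff_one (k : ℕ) : PowerSeries.coeff k (of.symm (1 : HadamardSeries R)) = 1 :=
  PowerSeries.coeff_mk k fun _ => 1

theorem ext {f g : HadamardSeries R}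
    (h : ∀ k, PowerSeries.coeff k (of.symm f) = PowerSeries.coeff k (of.symm g)) : f = g :=
  of.symm.injective (PowerSeries.ext h)

noncomputable instance : CommRing (HadamardSeries R) :=
  { (inferInstance : AddCommGroup (HadamardSeries R)),
    (inferInstance : Mul (HadamardSeries R)),
    (inferInstance : One (HadamardSeries R)) with
    left_distrib := fun f g h => ext fun k => by simp [coeff_mul, mul_add]
    right_distrib := fun f g h => ext fun k => by simp [coeff_mul, add_mul]
    zero_mul := fun f => ext fun k => by simp [coeff_mul]
    mul_zero := fun f => ext fun k => by simp [coeff_mul]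
    mul_assoc := fun f g h => ext fun k => by simp [coeff_mul, mul_assoc]
    one_mul := fun f => ext fun k => by simp [coeff_mul, coeff_one]
    mul_one := fun f => ext fun k => by simp [coeff_mul, coeff_one]
    mul_comm := fun f g => ext fun k => by simp [coeff_mul, mul_comm] }

noncomputable instance [Algebra ℚ R] : Module ℚ (HadamardSeries R) :=
  inferInstanceAs (Module ℚ (PowerSeries R))

theorem coeff_smul [Algebra ℚ R] (c : ℚ) (f : HadamardSeries R) (k : ℕ) :
    PowerSeries.coeff k (of.symm (c • f)) = c • PowerSeries.coeff k (of.symm f) := rfl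

noncomputable instance [Algebra ℚ R] : Algebra ℚ (HadamardSeries R) :=
  Algebra.ofModule (fun c f g => ext fun k => by simp [coeff_mul, coeff_smul])
    (fun c f g => ext fun k => by simp [coeff_mul, coeff_smul])

end HadamardSeries

/-! ### The rational functions -/

/-- The variables `p₀, …, p_{r-1}, x, z`. -/
inductive Var (r : ℕ) : Type
  | p (j : Fin r)
  | x
  | z

/-- The polynomial ring `ℚ[p₀, …, p_{r-1}, x, z]`. -/
abbrev Coeffs (r : ℕ) : Type := MvPolynomial (Var r) ℚ

/-- The power series `(1 - t)(1 - x t) ⋯ (1 - xⁿ t)`. -/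
noncomputable def denom (r n : ℕ) : PowerSeries (Coeffs r) :=
  ∏ i ∈ Finset.range (n + 1), (1 - PowerSeries.C (MvPolynomial.X Var.x ^ i) * PowerSeries.X)

theorem constantCoeff_denom (r n : ℕ) : PowerSeries.constantCoeff (denom r n) = 1 := by
  simp [denom, map_prod]

/-- The power series `1 / ((1 - t)(1 - x t) ⋯ (1 - xⁿ t))`. -/
noncomputable def invDenom (r n : ℕ) : PowerSeries (Coeffs r) :=
  PowerSeries.invOfUnit (denom r n) 1

theorem denom_mul_invDenom (r n : ℕ) : denom r n * invDenom r n = 1 :=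
  PowerSeries.mul_invOfUnit _ _ (constantCoeff_denom r n)

end ColouredShuffle

/-! The argument is a coloured form of Stanley's theory of `P`-partitions. Attach to each letter of
a word a label in `{0, …, k-1}` so that the labels increase weakly, increase strictly at each
descent, and start at a positive value if the first colour is not `0`. Weight a labelling by `x` to
the sum of its labels. Summing over the labels one letter at a time, from the right, is a chain of
geometric series. The resulting enumerator is the coefficient of `t^k` in `x^comaj t^(des+1) /
((1-t)⋯(1-xⁿt))` (`labelEnum_admissible`).

The conditions say that the labelled letters form an increasing chain for one fixed total order, all
of it inside the up-set of admissible labelled letters. A chain on `a` and a chain on `b` with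
disjoint letters therefore merge in exactly one way into a chain on a shuffle of `a` and `b`, and
every chain on a shuffle restricts to such a pair. So for each `k` the enumerators are
multiplicative (`labelEnum_shuffle`), and coefficientwise multiplicativity is multiplicativity for
the Hadamard product (`sum_series_shuffle`).

For injectivity, the lowest term in `t` of each series is a single monomial. It determines length,
`comaj` and colours, and its degree in `t` determines `des`; hence the series of distinct classes
are linearly independent. Shuffle compatibility follows as well: the sum of the series over the
shuffles is the product of two series that depend only on the classes of `a` and `b`, and
independence recovers the multiset of classes from that sum. -/

namespace ColouredShuffle

/-! ### Labelled words and the multiplicativity of their enumerators -/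

section Labelled

variable {r : ℕ}

theorem ColourLT.irrefl (u : ℕ+ × Fin r) : ¬ ColourLT u u := by
  simp [ColourLT]

theorem ColourLT.trans {u v w : ℕ+ × Fin r} (h : ColourLT u v) (h' : ColourLT v w) :
    ColourLT u w := by
  simp only [ColourLT] at *
  rcases h with h | ⟨h, k⟩ <;> rcases h' with h' | ⟨h', k'⟩
  · exact Or.inl (h'.trans h)
  · exact Or.inl (h' ▸ h)
  · exact Or.inl (h ▸ h')
  · exact Or.inr ⟨h.trans h', k.trans k'⟩

theorem ColourLT.trichotomy (u v : ℕ+ × Fin r) : ColourLT u v ∨ u = v ∨ ColourLT v u := by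
  simp only [ColourLT, Prod.ext_iff]
  rcases lt_trichotomy u.2 v.2 with h | h | h
  · exact Or.inr (Or.inr (Or.inl h))
  · rcases lt_trichotomy u.1 v.1 with k | k | k
    · exact Or.inl (Or.inr ⟨h, k⟩)
    · exact Or.inr (Or.inl ⟨k, h⟩)
    · exact Or.inr (Or.inr (Or.inr ⟨h.symm, k⟩))
  · exact Or.inl (Or.inl h)

/-- The lexicographic total order on letters labelled by natural numbers. -/
def LabelLE (u v : ℕ × (ℕ+ × Fin r)) : Prop :=
  u.1 < v.1 ∨ (u.1 = v.1 ∧ ¬ ColourLT v.2 u.2)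

theorem LabelLE.trans {u v w : ℕ × (ℕ+ × Fin r)} (h : LabelLE u v) (h' : LabelLE v w) :
    LabelLE u w := by
  simp only [LabelLE] at *
  rcases h with h | ⟨h, k⟩ <;> rcases h' with h' | ⟨h', k'⟩
  · exact Or.inl (h.trans h')
  · exact Or.inl (h' ▸ h)
  · exact Or.inl (h ▸ h')
  · refine Or.inr ⟨h.trans h', fun hc => ?_⟩
    rcases ColourLT.trichotomy v.2 w.2 with e | e | e
    · exact k (e.trans hc)
    · exact k (e ▸ hc)
    · exact k' e

/-- For distinct letters the order is total and antisymmetric. This makes the merge of two labelled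
words unique: of two competing first letters exactly one can come first. -/
theorem LabelLE.not_iff {u v : ℕ × (ℕ+ × Fin r)} (h : u.2 ≠ v.2) :
    ¬ LabelLE u v ↔ LabelLE v u := by
  have h1 : ¬ (ColourLT u.2 v.2 ∧ ColourLT v.2 u.2) := fun h => ColourLT.irrefl _ (h.1.trans h.2)
  have h2 := ColourLT.trichotomy u.2 v.2
  simp only [LabelLE]
  rcases lt_trichotomy u.1 v.1 with h3 | h3 | h3
  · simp [h3, h3.not_gt, h3.ne']
  · simp only [h3, lt_irrefl, true_and, false_or]
    tauto
  · simp [h3, h3.not_gt, h3.ne']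

/-- A letter labelled `0` must have colour `0`. -/
def Admissible (u : ℕ × (ℕ+ × Fin r)) : Prop := u.1 = 0 → (u.2.2 : ℕ) = 0

/-- Letters of colour `0` are the largest in the colour order, so a letter that follows one of them
with the same label `0` also has colour `0`. Hence a condition on the first letter alone controls
the whole chain. -/
theorem Admissible.of_labelLE {u v : ℕ × (ℕ+ × Fin r)} (hu : Admissible u) (h : LabelLE u v) :
    Admissible v := by
  intro hv
  simp only [LabelLE, hv, not_lt_zero, false_or] at h
  have h0 := hu h.1
  have h1 := h.2
  simp only [ColourLT, not_or, not_lt, Fin.le_def] at h1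
  omega

variable {R : Type*} [CommSemiring R]

open Classical in
/-- The enumerator, by `x` to the sum of the labels, of the weakly increasing labellings of a word
with labels less than `k` whose first labelled letter satisfies `P`. -/
noncomputable def labelEnum (x : R) (k : ℕ) :
    List (ℕ+ × Fin r) → (ℕ × (ℕ+ × Fin r) → Prop) → R
  | [], _ => 1
  | y :: w, P => ∑ j ∈ Finset.range k,
      if P (j, y) then x ^ j * labelEnum x k w (LabelLE (j, y)) else 0

open Classical in
theorem sum_map_labelEnum_cons (x : R) (k : ℕ) (y : ℕ+ × Fin r)
    (P : ℕ × (ℕ+ × Fin r) → Prop) (S : Multiset (List (ℕ+ × Fin r))) :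
    (S.map (fun c => labelEnum x k (y :: c) P)).sum = ∑ j ∈ Finset.range k,
      if P (j, y) then x ^ j * (S.map (fun c => labelEnum x k c (LabelLE (j, y)))).sum else 0 := by
  simp only [labelEnum]
  rw [Multiset.sum_map_sum]
  refine Finset.sum_congr rfl fun j _ => ?_
  split_ifs
  · rw [Multiset.sum_map_mul_left]
  · simp

/-- The enumerators of admissible labellings are multiplicative for the shuffle product. -/
theorem labelEnum_shuffle (x : R) (k : ℕ) (a b : List (ℕ+ × Fin r))
    (hab : ∀ u ∈ a, ∀ v ∈ b, u ≠ v) (P : ℕ × (ℕ+ × Fin r) → Prop)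
    (hP : ∀ u v, P u → LabelLE u v → P v) :
    ((wordShuffle a b).map (fun c => labelEnum x k c P)).sum =
      labelEnum x k a P * labelEnum x k b P := by
  classical
  induction a generalizing b P with
  | nil => simp [wordShuffle_nil_left, labelEnum]
  | cons y a iha =>
    induction b generalizing P with
    | nil => simp [wordShuffle_nil_right, labelEnum]
    | cons z b ihb =>
      have hyz : y ≠ z := hab y (by simp) z (by simp)
      rw [wordShuffle_cons_cons, Multiset.map_add, Multiset.sum_add, Multiset.map_map,
        Multiset.map_map]
      simp only [Function.comp_def]
      rw [sum_map_labelEnum_cons, sum_map_labelEnum_cons]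
      have h1 : ∀ i, ((wordShuffle a (z :: b)).map
          (fun c => labelEnum x k c (LabelLE (i, y)))).sum = _ := fun i =>
        iha (z :: b) (fun u hu => hab u (by simp [hu])) (LabelLE (i, y)) fun _ _ => LabelLE.trans
      have h2 : ∀ j, ((wordShuffle (y :: a) b).map
          (fun c => labelEnum x k c (LabelLE (j, z)))).sum = _ := fun j =>
        ihb (fun u hu v hv => hab u hu v (by simp [hv])) (LabelLE (j, z)) fun _ _ => LabelLE.trans
      simp only [h1, h2]
      simp only [labelEnum, Finset.mul_sum, Finset.sum_mul]
      have e : ∀ (p : Prop) [Decidable p] (f : ℕ → R),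
          (if p then ∑ i ∈ Finset.range k, f i else 0) =
            ∑ i ∈ Finset.range k, if p then f i else 0 := by
        intro p _ f
        split_ifs <;> simp
      simp only [e]
      rw [Finset.sum_comm, ← Finset.sum_add_distrib]
      refine Finset.sum_congr rfl fun j _ => ?_
      rw [← Finset.sum_add_distrib]
      refine Finset.sum_congr rfl fun i _ => ?_
      -- It remains to compare summands with label `i` on `y` and `j` on `z`. The right side
      -- requires `P` of both labelled letters, the left side `P` of the smaller one only. Since `P`
      -- is upward closed, these agree, and exactly one of the two terms on the left survives.
      have hi := hP (i, y) (j, z)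
      have hj := hP (j, z) (i, y)
      rw [← LabelLE.not_iff (u := (i, y)) (v := (j, z)) hyz] at hj
      simp only [← LabelLE.not_iff (u := (i, y)) (v := (j, z)) hyz]
      generalize LabelLE (i, y) (j, z) = l at hi hj ⊢
      generalize P (i, y) = p at hi hj ⊢
      generalize P (j, z) = q at hi hj ⊢
      by_cases hp : p <;> by_cases hq : q <;> by_cases hl : l <;>
        simp only [hp, hq, hl, if_true, if_false, mul_zero, zero_mul, add_zero, zero_add,
          not_true_eq_false, not_false_eq_true] at hi hj ⊢
      · ring
      · ring
      · exact (hi trivial trivial).elim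
      · exact (hj trivial trivial).elim

end Labelled

/-! ### Evaluation of the enumerators as coefficients of rational functions -/

section ClosedForm

variable {r : ℕ}

/-- The sum of `g i` over the descents of a word with preceding letter `z`, where `i` is the
number of letters weakly to the right of the descent bottom. -/
def descSum (g : ℕ → ℕ) : ℕ+ × Fin r → List (ℕ+ × Fin r) → ℕ
  | _, [] => 0
  | z, y :: w => (if ColourLT y z then g (w.length + 1) else 0) + descSum g y w

theorem sum_range_descents (g : ℕ → ℕ) (z : ℕ+ × Fin r) (w : List (ℕ+ × Fin r)) :
    (∑ i ∈ Finset.range w.length, if ∃ h : i < w.length,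
      ColourLT w[i] ((z :: w)[i]'(by simp; omega)) then g (w.length - i) else 0) =
      descSum g z w := by
  induction w generalizing z with
  | nil => simp [descSum]
  | cons y w ih =>
    rw [descSum, ← ih y, add_comm]
    simp only [List.length_cons]
    rw [Finset.sum_range_succ']
    simp

/-- Taking `g` constantly `1` gives `des`, and `g = id` gives `comaj`. The descent at index `0` is
the only one governed by a colour instead of a comparison, so it is split off. -/
theorem ColPerm.sum_Des (g : ℕ → ℕ) (a : ColPerm r) (y : ℕ+ × Fin r) (w : List (ℕ+ × Fin r))
    (h : a.word = y :: w) :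
    ∑ i ∈ a.Des, g (a.length - i) =
      (if (y.2 : ℕ) ≠ 0 then g (w.length + 1) else 0) + descSum g y w := by
  obtain ⟨_, hn⟩ := a
  subst h
  rw [Des, Finset.sum_filter, ← sum_range_descents, length]
  simp only [List.length_cons]
  rw [Finset.sum_range_succ', add_comm]
  simp

theorem denom_succ (n : ℕ) : denom r (n + 1) =
    denom r n * (1 - PowerSeries.C (MvPolynomial.X Var.x ^ (n + 1)) * PowerSeries.X) := by
  rw [denom, Finset.prod_range_succ, denom]

theorem invDenom_succ (n : ℕ) : invDenom r (n + 1) = invDenom r n +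
    PowerSeries.C (MvPolynomial.X Var.x ^ (n + 1)) * PowerSeries.X * invDenom r (n + 1) := by
  have h1 := denom_mul_invDenom r n
  have h2 := denom_mul_invDenom r (n + 1)
  rw [denom_succ] at h2
  linear_combination invDenom r n * h2 - (1 - PowerSeries.C (MvPolynomial.X Var.x ^ (n + 1)) *
    PowerSeries.X) * invDenom r (n + 1) * h1

theorem coeff_invDenom_zero (k : ℕ) : PowerSeries.coeff k (invDenom r 0) = 1 := by
  have h1 := denom_mul_invDenom r 0
  have h2 : (1 - PowerSeries.X) * PowerSeries.mk (fun _ => (1 : Coeffs r)) = 1 := by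
    rw [mul_comm]; exact PowerSeries.mk_one_mul_one_sub_eq_one _
  have h3 : denom r 0 = 1 - PowerSeries.X := by simp [denom]
  rw [h3] at h1
  have : invDenom r 0 = PowerSeries.mk (fun _ => (1 : Coeffs r)) := by
    linear_combination PowerSeries.mk (fun _ => (1 : Coeffs r)) * h1 - invDenom r 0 * h2
  rw [this, PowerSeries.coeff_mk]

/-- This expands the new factor `1/(1 - x^(n+1) t)` as a geometric series. The terms with `j ≥ k`
may be dropped, because `t^(j+1+d)` does not reach the coefficient of `t^k`. -/
theorem sum_coeff_invDenom (n d m k : ℕ) :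
    ∑ j ∈ Finset.range k, (if m ≤ j then PowerSeries.coeff k
      (PowerSeries.C ((MvPolynomial.X Var.x : Coeffs r) ^ (j * (n + 1))) *
        PowerSeries.X ^ (j + 1 + d) * invDenom r n) else 0) =
      PowerSeries.coeff k (PowerSeries.C ((MvPolynomial.X Var.x : Coeffs r) ^ (m * (n + 1))) *
        PowerSeries.X ^ (m + 1 + d) * invDenom r (n + 1)) := by
  by_cases hm : k ≤ m
  · rw [Finset.sum_eq_zero, mul_right_comm, PowerSeries.coeff_mul_X_pow', if_neg (by omega)]
    intro j hj
    rw [Finset.mem_range] at hj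
    rw [if_neg (by omega)]
  · induction hm' : k - m generalizing m with
    | zero => omega
    | succ i ih =>
      have hs : ∑ j ∈ Finset.range k, (if m + 1 ≤ j then PowerSeries.coeff k
          (PowerSeries.C ((MvPolynomial.X Var.x : Coeffs r) ^ (j * (n + 1))) *
            PowerSeries.X ^ (j + 1 + d) * invDenom r n) else 0) =
          PowerSeries.coeff k
            (PowerSeries.C ((MvPolynomial.X Var.x : Coeffs r) ^ ((m + 1) * (n + 1))) *
            PowerSeries.X ^ (m + 1 + 1 + d) * invDenom r (n + 1)) := by
        by_cases h : k ≤ m + 1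
        · rw [Finset.sum_eq_zero, mul_right_comm, PowerSeries.coeff_mul_X_pow', if_neg (by omega)]
          intro j hj
          rw [Finset.mem_range] at hj
          rw [if_neg (by omega)]
        · exact ih (m + 1) h (by omega)
      -- The recursion splits the right side into the term `j = m` and the same expression with `m +
      -- 1` in place of `m`.
      rw [invDenom_succ, mul_add, map_add]
      have e : PowerSeries.C ((MvPolynomial.X Var.x : Coeffs r) ^ (m * (n + 1))) *
          PowerSeries.X ^ (m + 1 + d) * (PowerSeries.C (MvPolynomial.X Var.x ^ (n + 1)) *
          PowerSeries.X * invDenom r (n + 1)) =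
          PowerSeries.C ((MvPolynomial.X Var.x : Coeffs r) ^ ((m + 1) * (n + 1))) *
            PowerSeries.X ^ (m + 1 + 1 + d) * invDenom r (n + 1) := by
        simp only [map_pow]
        ring
      rw [e, ← hs, ← Finset.sum_erase_add _ _ (Finset.mem_range.mpr (not_le.mp hm)),
        ← Finset.sum_erase_add (Finset.range k) (fun j => if m + 1 ≤ j then _ else _)
          (Finset.mem_range.mpr (not_le.mp hm)), if_pos le_rfl, if_neg (by omega), add_zero,
        add_comm]
      congr 1
      refine Finset.sum_congr rfl fun j hj => ?_
      have hj' := Finset.ne_of_mem_erase hj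
      simp only [show m ≤ j ↔ m + 1 ≤ j by omega]

/-- The inductive step for one letter. The label `i` of `y` contributes `x^i`, which turns the
exponent `i * w.length` of the tail into `i * (w.length + 1)`. Summation over `m ≤ i < k` then adds
a factor to the denominator. -/
theorem labelEnum_cons_eq_coeff (k m : ℕ) (y : ℕ+ × Fin r) (w : List (ℕ+ × Fin r))
    (P : ℕ × (ℕ+ × Fin r) → Prop) (hP : ∀ i, P (i, y) ↔ m ≤ i)
    (h : ∀ i < k, labelEnum (MvPolynomial.X Var.x : Coeffs r) k w (LabelLE (i, y)) =
      PowerSeries.coeff k (PowerSeries.C ((MvPolynomial.X Var.x : Coeffs r) ^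
        (i * w.length + descSum id y w)) *
        PowerSeries.X ^ (i + 1 + descSum (fun _ => 1) y w) * invDenom r w.length)) :
    labelEnum (MvPolynomial.X Var.x : Coeffs r) k (y :: w) P =
      PowerSeries.coeff k (PowerSeries.C ((MvPolynomial.X Var.x : Coeffs r) ^
        (m * (w.length + 1) + descSum id y w)) *
        PowerSeries.X ^ (m + 1 + descSum (fun _ => 1) y w) * invDenom r (w.length + 1)) := by
  have e : PowerSeries.C ((MvPolynomial.X Var.x : Coeffs r) ^
        (m * (w.length + 1) + descSum id y w)) *
        PowerSeries.X ^ (m + 1 + descSum (fun _ => 1) y w) * invDenom r (w.length + 1) =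
      PowerSeries.C ((MvPolynomial.X Var.x : Coeffs r) ^ descSum id y w) *
        (PowerSeries.C ((MvPolynomial.X Var.x : Coeffs r) ^ (m * (w.length + 1))) *
        PowerSeries.X ^ (m + 1 + descSum (fun _ => 1) y w) * invDenom r (w.length + 1)) := by
    simp only [pow_add, map_mul]
    ring
  rw [e, PowerSeries.coeff_C_mul, ← sum_coeff_invDenom, Finset.mul_sum, labelEnum]
  refine Finset.sum_congr rfl fun i hi => ?_
  simp only [hP, h i (Finset.mem_range.mp hi), mul_ite, mul_zero]
  refine if_congr Iff.rfl ?_ rfl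
  have e2 : PowerSeries.C ((MvPolynomial.X Var.x : Coeffs r) ^ i) *
      (PowerSeries.C ((MvPolynomial.X Var.x : Coeffs r) ^ (i * w.length + descSum id y w)) *
        PowerSeries.X ^ (i + 1 + descSum (fun _ => 1) y w) * invDenom r w.length) =
      PowerSeries.C ((MvPolynomial.X Var.x : Coeffs r) ^ descSum id y w) *
      (PowerSeries.C ((MvPolynomial.X Var.x : Coeffs r) ^ (i * (w.length + 1))) *
        PowerSeries.X ^ (i + 1 + descSum (fun _ => 1) y w) * invDenom r w.length) := by
    simp only [pow_add, mul_add, mul_one, map_mul]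
    ring
  rw [← PowerSeries.coeff_C_mul, ← PowerSeries.coeff_C_mul, e2]

/-- A descent raises the least permitted label by `1`. The increase is inherited by every letter
weakly to its right, so it costs one power of `t` and as many powers of `x` as there are such
letters. The bound `j < k` makes the coefficient for the empty word equal to `1`. -/
theorem labelEnum_labelLE (k j : ℕ) (hj : j < k) (z : ℕ+ × Fin r) (w : List (ℕ+ × Fin r)) :
    labelEnum (MvPolynomial.X Var.x : Coeffs r) k w (LabelLE (j, z)) =
      PowerSeries.coeff k (PowerSeries.C ((MvPolynomial.X Var.x : Coeffs r) ^
        (j * w.length + descSum id z w)) *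
        PowerSeries.X ^ (j + 1 + descSum (fun _ => 1) z w) * invDenom r w.length) := by
  induction w generalizing j z with
  | nil =>
    simp [labelEnum, descSum, PowerSeries.coeff_X_pow_mul', coeff_invDenom_zero,
      Nat.succ_le_of_lt hj]
  | cons y w ih =>
    rw [labelEnum_cons_eq_coeff k (j + if ColourLT y z then 1 else 0) y w (LabelLE (j, z))
      (fun i => by by_cases hc : ColourLT y z <;> simp [LabelLE, hc] <;> omega)
      (fun i hi => ih i hi y)]
    simp only [descSum, List.length_cons, id]
    congr 2
    split_ifs <;> ring_nf

/-- The enumerator of admissible labellings of a nonempty coloured permutation is a coefficient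
of the rational function of its descent number and comajor index. -/
theorem labelEnum_admissible (k : ℕ) (a : ColPerm r) (ha : 1 ≤ a.length) :
    labelEnum (MvPolynomial.X Var.x : Coeffs r) k a.word Admissible =
      PowerSeries.coeff k (PowerSeries.C ((MvPolynomial.X Var.x : Coeffs r) ^ a.comaj) *
        PowerSeries.X ^ (a.des + 1) * invDenom r a.length) := by
  obtain ⟨y, w, h⟩ : ∃ y w, a.word = y :: w := List.exists_cons_of_length_pos ha
  have h1 := a.sum_Des (fun _ => 1) y w h
  have h2 := a.sum_Des id y w h
  rw [Finset.sum_const, smul_eq_mul, mul_one, ← ColPerm.des] at h1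
  simp only [id] at h2
  rw [← ColPerm.comaj] at h2
  have h3 : a.length = w.length + 1 := by simp [ColPerm.length, h]
  -- The least admissible label of the first letter. It is `1` exactly when `0` is a descent, and
  -- then it accounts for `1` in `des` and the full length in `comaj`.
  set m := if (y.2 : ℕ) ≠ 0 then 1 else 0 with hm
  have h4 : (if (y.2 : ℕ) ≠ 0 then w.length + 1 else 0) = m * (w.length + 1) := by
    rw [hm]; split_ifs <;> simp
  have h5 : m + 1 + descSum (fun _ => 1) y w = m + descSum (fun _ => 1) y w + 1 := by omega
  have h6 : ∀ i, Admissible (i, y) ↔ m ≤ i := fun i => by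
    by_cases hc : (y.2 : ℕ) = 0
    · simp [hm, Admissible, hc]
    · simp [hm, Admissible, hc]
      omega
  rw [h1, h2, h3, h, labelEnum_cons_eq_coeff k m y w Admissible h6
    (fun i hi => labelEnum_labelLE k i hi y w), h4, h5]

end ClosedForm

/-! ### Linear independence from lowest terms -/

section LinearIndependence

/-- In a vanishing combination choose `i` in the support with `d i` minimal and read off the
coefficient of `t^(d i)` at the monomial `m i`. Series starting later contribute nothing, and series
starting at the same degree have other monomials, so the coefficient `l i` is isolated. -/
theorem linearIndependent_of_leading_monomial {ι σ : Type*}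
    (f : ι → HadamardSeries (MvPolynomial σ ℚ)) (d : ι → ℕ) (m : ι → σ →₀ ℕ)
    (hlow : ∀ i k, k < d i → PowerSeries.coeff k (HadamardSeries.of.symm (f i)) = 0)
    (hlead : ∀ i, PowerSeries.coeff (d i) (HadamardSeries.of.symm (f i)) =
      MvPolynomial.monomial (m i) 1)
    (hinj : ∀ i j, d i = d j → m i = m j → i = j) : LinearIndependent ℚ f := by
  classical
  rw [linearIndependent_iff]
  intro l hl
  by_contra hne
  obtain ⟨i, hi, hmin⟩ := l.support.exists_min_image d (Finsupp.support_nonempty_iff.mpr hne)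
  have h1 : ∑ j ∈ l.support, l j * MvPolynomial.coeff (m i)
      (PowerSeries.coeff (d i) (HadamardSeries.of.symm (f j))) = 0 := by
    have h2 : PowerSeries.coeff (d i) (HadamardSeries.of.symm
        (∑ j ∈ l.support, l j • f j)) = 0 := by
      rw [Finsupp.linearCombination_apply, Finsupp.sum] at hl
      rw [hl, map_zero, map_zero]
    rw [map_sum, map_sum] at h2
    have h3 := congrArg (MvPolynomial.coeff (m i)) h2
    rw [MvPolynomial.coeff_sum, MvPolynomial.coeff_zero] at h3
    exact h3
  rw [Finset.sum_eq_single i] at h1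
  · rw [hlead, MvPolynomial.coeff_monomial, if_pos rfl, mul_one] at h1
    exact Finsupp.mem_support_iff.mp hi h1
  · intro j hj hji
    rcases (hmin j hj).lt_or_eq with h | h
    · rw [hlow j _ h, MvPolynomial.coeff_zero, mul_zero]
    · rw [h, hlead, MvPolynomial.coeff_monomial, if_neg, mul_zero]
      exact fun hm => hji (hinj j i h.symm hm)
  · intro h
    exact absurd hi h

end LinearIndependence

/-! ### The series of a class, shuffle compatibility and the homomorphism -/

section Hom

variable {r : ℕ}

/-- The exponent of the monomial attached to a coloured permutation. -/
noncomputable def ColPerm.exponent (a : ColPerm r) : Var r →₀ ℕ :=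
  ∑ j : Fin r, Finsupp.single (Var.p j) (a.col j) + Finsupp.single Var.x a.comaj +
    Finsupp.single Var.z a.length

/-- The monomial recording the colours and the length of a coloured permutation. -/
noncomputable def ColPerm.colourWeight (a : ColPerm r) : Coeffs r :=
  (∏ j : Fin r, MvPolynomial.X (Var.p j) ^ a.col j) * MvPolynomial.X Var.z ^ a.length

/-- The series attached to a coloured permutation. -/
noncomputable def ColPerm.series (a : ColPerm r) : HadamardSeries (Coeffs r) :=
  HadamardSeries.of (if a.length = 0 then PowerSeries.invOfUnit (1 - PowerSeries.X) 1 else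
    PowerSeries.C ((∏ j : Fin r, MvPolynomial.X (Var.p j) ^ a.col j) *
      MvPolynomial.X Var.x ^ a.comaj * MvPolynomial.X Var.z ^ a.length) *
      PowerSeries.X ^ (a.des + 1) * invDenom r a.length)

theorem coeff_invOfUnit_one_sub_X {R : Type*} [CommRing R] (k : ℕ) :
    PowerSeries.coeff k (PowerSeries.invOfUnit (1 - PowerSeries.X : PowerSeries R) 1) = 1 := by
  have h1 := PowerSeries.mul_invOfUnit (1 - PowerSeries.X : PowerSeries R) 1 (by simp)
  have h2 := PowerSeries.mk_one_mul_one_sub_eq_one R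
  have : PowerSeries.invOfUnit (1 - PowerSeries.X : PowerSeries R) 1 = PowerSeries.mk 1 := by
    linear_combination PowerSeries.mk 1 * h1 -
      PowerSeries.invOfUnit (1 - PowerSeries.X : PowerSeries R) 1 * h2
  simp [this]

namespace ColPerm

theorem word_eq_nil {a : ColPerm r} (h : a.length = 0) : a.word = [] :=
  List.length_eq_zero_iff.mp h

/-- The link between the two descriptions. The empty word has enumerator `1` for every `k`,
including `k = 0`; this is why its series is `1/(1-t)` and not the value `t/(1-t)` of the general
formula. -/
theorem coeff_series (a : ColPerm r) (k : ℕ) :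
    PowerSeries.coeff k (HadamardSeries.of.symm a.series) =
      a.colourWeight * labelEnum (MvPolynomial.X Var.x) k a.word Admissible := by
  rw [series, AddEquiv.symm_apply_apply]
  split_ifs with h
  · have h' := word_eq_nil h
    simp [coeff_invOfUnit_one_sub_X, colourWeight, h', labelEnum, col, length]
  · rw [labelEnum_admissible k a (by omega), ← PowerSeries.coeff_C_mul, colourWeight]
    congr 1
    simp only [map_mul]
    ring

theorem coeff_series_of_lt (a : ColPerm r) (k : ℕ)
    (hk : k < if a.length = 0 then 0 else a.des + 1) :
    PowerSeries.coeff k (HadamardSeries.of.symm a.series) = 0 := by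
  rw [series, AddEquiv.symm_apply_apply]
  split_ifs at hk ⊢
  · omega
  rw [mul_right_comm, PowerSeries.coeff_mul_X_pow', if_neg (by omega)]

theorem coeff_series_lead (a : ColPerm r) :
    PowerSeries.coeff (if a.length = 0 then 0 else a.des + 1) (HadamardSeries.of.symm a.series) =
      MvPolynomial.monomial a.exponent 1 := by
  have he : MvPolynomial.monomial a.exponent (1 : ℚ) =
      (∏ j : Fin r, MvPolynomial.X (Var.p j) ^ a.col j) *
        MvPolynomial.X Var.x ^ a.comaj * MvPolynomial.X Var.z ^ a.length := by
    simp only [exponent, MvPolynomial.X_pow_eq_monomial, MvPolynomial.monomial_mul, mul_one,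
      ← MvPolynomial.monomial_sum_one]
  rw [he, series, AddEquiv.symm_apply_apply]
  split_ifs with h
  · have h' := word_eq_nil h
    rw [coeff_invOfUnit_one_sub_X]
    simp [h', col, length, comaj, Des]
  · have hc : PowerSeries.constantCoeff (invDenom r a.length) = 1 := by
      simp [invDenom]
    rw [mul_assoc, PowerSeries.coeff_C_mul, PowerSeries.coeff_X_pow_mul', if_pos le_rfl]
    simp [hc]

theorem exponent_injective {a b : ColPerm r} (h : a.exponent = b.exponent) :
    a.length = b.length ∧ a.comaj = b.comaj ∧ a.col = b.col := by
  classical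
  refine ⟨?_, ?_, ?_⟩
  · simpa [exponent, Finsupp.single_apply] using DFunLike.congr_fun h Var.z
  · simpa [exponent, Finsupp.single_apply] using DFunLike.congr_fun h Var.x
  · funext j
    simpa [exponent, Finsupp.single_apply] using DFunLike.congr_fun h (Var.p j)

theorem des_eq_zero {a : ColPerm r} (h : a.length = 0) : a.des = 0 := by
  simp [des, Des, word_eq_nil h]

theorem series_eq_of_classOf_eq {a b : ColPerm r}
    (h : (desComajCol r).classOf a = (desComajCol r).classOf b) : a.series = b.series := by
  obtain ⟨hl, hv⟩ := (Statistic.classOf_eq_iff _ _ _).mp h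
  simp only [desComajCol, Prod.mk.injEq] at hv
  simp only [series, hl, hv]

/-- Colours and lengths add under shuffling, so the colour weight is a common factor of all
shuffles. What is left in each coefficient is `labelEnum_shuffle` for the up-set `Admissible`. -/
theorem sum_series_shuffle (a b : ColPerm r) (h : a.Disj b) :
    ((a.shuffle b h).map series).sum = a.series * b.series := by
  have hw : ∀ c ∈ a.shuffle b h, c.colourWeight = a.colourWeight * b.colourWeight := by
    intro c hc
    have hl := length_of_mem_shuffle h hc
    rw [shuffle, Multiset.mem_pmap] at hc
    obtain ⟨w, hw, rfl⟩ := hc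
    have hp := (perm_of_mem_wordShuffle _ _ w hw).map Prod.snd
    have hcol : ∀ j, col ⟨w, word_nodup_of_shuffle h w hw⟩ j = a.col j + b.col j := fun j => by
      simp only [col]
      rw [hp.count_eq, List.map_append, List.count_append]
    simp only [colourWeight, hl, hcol, pow_add, Finset.prod_mul_distrib]
    ring
  have hne : ∀ u ∈ a.word, ∀ v ∈ b.word, u ≠ v := by
    rintro u hu _ hv rfl
    exact Finset.disjoint_left.mp h (List.mem_toFinset.mpr (List.mem_map_of_mem hu))
      (List.mem_toFinset.mpr (List.mem_map_of_mem hv))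
  refine HadamardSeries.ext fun k => ?_
  rw [HadamardSeries.coeff_mul, coeff_series, coeff_series, mul_mul_mul_comm,
    ← labelEnum_shuffle _ k _ _ hne _ fun _ _ => Admissible.of_labelLE, map_multiset_sum,
    map_multiset_sum, Multiset.map_map, Multiset.map_map, ← Multiset.sum_map_mul_left]
  have e : (a.shuffle b h).map (fun c => a.colourWeight * b.colourWeight *
      labelEnum (MvPolynomial.X Var.x) k c.word Admissible) =
      (wordShuffle a.word b.word).map (fun c => a.colourWeight * b.colourWeight *
        labelEnum (MvPolynomial.X Var.x) k c Admissible) := by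
    rw [shuffle, Multiset.map_pmap, ← Multiset.pmap_eq_map (p := fun w => (w.map Prod.fst).Nodup)
      (H := word_nodup_of_shuffle h)]
  rw [← e]
  congr 1
  refine Multiset.map_congr rfl fun c hc => ?_
  simp only [Function.comp_apply]
  rw [coeff_series, hw c hc]

end ColPerm

/-- The series attached to an equivalence class of coloured permutations. -/
noncomputable def classSeries (q : (desComajCol r).Class) : HadamardSeries (Coeffs r) :=
  (Quotient.out q).series

theorem classSeries_classOf (a : ColPerm r) :
    classSeries ((desComajCol r).classOf a) = a.series :=
  ColPerm.series_eq_of_classOf_eq (Quotient.out_eq _)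

theorem linearIndependent_classSeries : LinearIndependent ℚ (classSeries (r := r)) := by
  refine linearIndependent_of_leading_monomial _
    (fun q => if (Quotient.out q).length = 0 then 0 else (Quotient.out q).des + 1)
    (fun q => (Quotient.out q).exponent) (fun q k hk => ColPerm.coeff_series_of_lt _ k hk)
    (fun q => ColPerm.coeff_series_lead _) fun q q' hd hm => ?_
  obtain ⟨hl, hm, hc⟩ := ColPerm.exponent_injective hm
  rw [← Quotient.out_eq q, ← Quotient.out_eq q']
  refine ((desComajCol r).classOf_eq_iff _ _).mpr ⟨hl, ?_⟩
  have hdes : (Quotient.out q).des = (Quotient.out q').des := by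
    -- In length `0` the starting degree is set to `0` and carries no information, but there both
    -- descent numbers vanish.
    rw [← hl] at hd
    split_ifs at hd with h0
    · rw [ColPerm.des_eq_zero h0, ColPerm.des_eq_zero (hl ▸ h0)]
    · omega
  simp only [desComajCol, hdes, hm, hc]

/-- Equal products of series give equal sums over the two sets of shuffles. By linear independence
the formal sums of classes agree, and their coefficients are the multiplicities of the classes. -/
theorem desComajCol_shuffleCompatible (r : ℕ) : (desComajCol r).ShuffleCompatible := by
  classical
  intro a b a' b' h h' ha hb hla hlb
  have hsa := ColPerm.series_eq_of_classOf_eq ((Statistic.classOf_eq_iff _ a a').mpr ⟨hla, ha⟩)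
  have hsb := ColPerm.series_eq_of_classOf_eq ((Statistic.classOf_eq_iff _ b b').mpr ⟨hlb, hb⟩)
  have hsum : ((a.shuffle b h).map ColPerm.series).sum =
      ((a'.shuffle b' h').map ColPerm.series).sum := by
    rw [ColPerm.sum_series_shuffle, ColPerm.sum_series_shuffle, hsa, hsb]
  have hlin : ∀ s : Multiset (ColPerm r), (s.map ColPerm.series).sum =
      Finsupp.linearCombination ℚ classSeries
        (s.map fun c => Finsupp.single ((desComajCol r).classOf c) (1 : ℚ)).sum := by
    intro s
    rw [map_multiset_sum, Multiset.map_map]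
    congr 1
    refine Multiset.map_congr rfl fun c _ => ?_
    simp [classSeries_classOf]
  rw [hlin, hlin] at hsum
  have hinj := linearIndependent_classSeries hsum
  have hcount : ∀ (s : Multiset (ColPerm r)) (q : (desComajCol r).Class),
      (s.map fun c => Finsupp.single ((desComajCol r).classOf c) (1 : ℚ)).sum q =
        ((s.map (desComajCol r).classOf).count q : ℚ) := by
    intro s q
    induction s using Multiset.induction_on with
    | empty => simp
    | cons c s ih =>
      rw [Multiset.map_cons, Multiset.sum_cons, Finsupp.add_apply, ih, Multiset.map_cons,
        Multiset.count_cons, Finsupp.single_apply]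
      push_cast
      rw [add_comm]
      simp only [eq_comm]
  have hclass : (a.shuffle b h).map (desComajCol r).classOf =
      (a'.shuffle b' h').map (desComajCol r).classOf := by
    ext q
    have := DFunLike.congr_fun hinj q
    rw [hcount, hcount] at this
    exact_mod_cast this
  -- The statistic factors through the class, so equal multisets of classes have equal multisets of
  -- values.
  have hlift : (desComajCol r).toFun = Quotient.lift (s := (desComajCol r).setoid)
      (desComajCol r).toFun (fun _ _ h => h.2) ∘ (desComajCol r).classOf := rfl
  rw [hlift, ← Multiset.map_map, ← Multiset.map_map, hclass]

/-- The linear map sending each class to its series. -/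
noncomputable def seriesMap (hst : (desComajCol r).ShuffleCompatible) :
    ShuffleAlgebra (desComajCol r) hst →ₗ[ℚ] HadamardSeries (Coeffs r) :=
  (ShuffleAlgebra.basis hst).constr ℚ classSeries

theorem seriesMap_mk (hst : (desComajCol r).ShuffleCompatible) (a : ColPerm r) :
    seriesMap hst (ShuffleAlgebra.mk hst a) = a.series := by
  rw [seriesMap, ShuffleAlgebra.mk, Module.Basis.constr_basis, classSeries_classOf]

theorem seriesMap_injective (hst : (desComajCol r).ShuffleCompatible) :
    Function.Injective (seriesMap hst) := by
  have h : ∀ u, seriesMap hst u = Finsupp.linearCombination ℚ classSeries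
      ((ShuffleAlgebra.basis hst).repr u) := fun u => by
    rw [seriesMap, Module.Basis.constr_apply, Finsupp.linearCombination_apply]
  intro u v huv
  rw [h, h] at huv
  exact (ShuffleAlgebra.basis hst).repr.injective (linearIndependent_classSeries huv)

theorem seriesMap_one (hst : (desComajCol r).ShuffleCompatible) : seriesMap hst 1 = 1 := by
  rw [ShuffleAlgebra.one_def, seriesMap_mk]
  refine HadamardSeries.ext fun k => ?_
  rw [HadamardSeries.coeff_one, ColPerm.series, AddEquiv.symm_apply_apply,
    if_pos (by simp [ColPerm.empty, ColPerm.length]), coeff_invOfUnit_one_sub_X]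

theorem seriesMap_mul (hst : (desComajCol r).ShuffleCompatible)
    (u v : ShuffleAlgebra (desComajCol r) hst) :
    seriesMap hst (u * v) = seriesMap hst u * seriesMap hst v := by
  revert u v
  rw [LinearMap.map_mul_iff]
  refine LinearMap.ext_basis (ShuffleAlgebra.basis hst) (ShuffleAlgebra.basis hst) fun q q' => ?_
  obtain ⟨a, -, ha⟩ := ShuffleAlgebra.exists_mk_eq (hst := hst) ∅ q
  obtain ⟨b, hab, hb⟩ := ShuffleAlgebra.exists_mk_eq (hst := hst) a.symbols q'
  rw [← ha, ← hb]
  change seriesMap hst (ShuffleAlgebra.mk hst a * ShuffleAlgebra.mk hst b) =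
    seriesMap hst (ShuffleAlgebra.mk hst a) * seriesMap hst (ShuffleAlgebra.mk hst b)
  rw [ShuffleAlgebra.mk_mul_mk a b hab, map_multiset_sum, Multiset.map_map, seriesMap_mk,
    seriesMap_mk, ← ColPerm.sum_series_shuffle a b hab]
  simp only [Function.comp_def, seriesMap_mk]

end Hom

end ColouredShuffle

theorem mainTheorem9 (r : ℕ) :
    ∃ hst : (ColouredShuffle.desComajCol r).ShuffleCompatible,
    ∃ H : ColouredShuffle.ShuffleAlgebra (ColouredShuffle.desComajCol r) hst →ₐ[ℚ]
        ColouredShuffle.HadamardSeries (MvPolynomial (ColouredShuffle.Var r) ℚ),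
      (∀ a : ColouredShuffle.ColPerm r, 1 ≤ a.length →
        H (ColouredShuffle.ShuffleAlgebra.mk hst a) =
          ColouredShuffle.HadamardSeries.of
            (PowerSeries.C ((∏ j : Fin r, MvPolynomial.X (ColouredShuffle.Var.p j) ^ a.col j) *
                MvPolynomial.X ColouredShuffle.Var.x ^ a.comaj *
                MvPolynomial.X ColouredShuffle.Var.z ^ a.length) *
              PowerSeries.X ^ (a.des + 1) * ColouredShuffle.invDenom r a.length)) ∧
      (∀ a : ColouredShuffle.ColPerm r, a.length = 0 →
        H (ColouredShuffle.ShuffleAlgebra.mk hst a) =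
          ColouredShuffle.HadamardSeries.of (PowerSeries.invOfUnit (1 - PowerSeries.X) 1)) ∧
      Function.Injective H := by
  have hst := ColouredShuffle.desComajCol_shuffleCompatible r
  refine ⟨hst, AlgHom.ofLinearMap (ColouredShuffle.seriesMap hst)
    (ColouredShuffle.seriesMap_one hst) (ColouredShuffle.seriesMap_mul hst), ?_, ?_, ?_⟩
  · intro a ha
    rw [AlgHom.ofLinearMap_apply, ColouredShuffle.seriesMap_mk, ColouredShuffle.ColPerm.series,
      if_neg (by omega)]
  · intro a ha
    rw [AlgHom.ofLinearMap_apply, ColouredShuffle.seriesMap_mk, ColouredShuffle.ColPerm.series,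
      if_pos ha]
  · exact ColouredShuffle.seriesMap_injective hst
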